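/- Let $\mathbb F_q$ be a finite field of odd characteristic, $f\in\mathbb F_q[x]$ a square-free polynomial of degree $3$, and $E$ the elliptic curve $y^2=f(x)$ with function field $F=\mathbb F_q(x,y)$ and point at infinity $O$. Let $T\subseteq\mathbb F_q$ be a set of $s$ elements $a$ for which $f(a)$ is a nonzero square, let $n=2s$, and let $P_m=(\alpha_m,\beta_m)$, $1\le m\le n$, be all the rational points of $E$ with $x$-coordinate in $T$ (in any order); so $\beta_m\neq 0$. Put $D=P_1+\dots+P_n$, $t=\prod_{a\in T}(x-a)$, $\omega=dx/t$, $\gamma_m=\mathrm{res}_{P_m}(\omega)$, and $$A_i=\sum_{m=1}^n\frac{\gamma_m}{\beta_m}\alpha_m^i,\qquad p_i=\sum_{m=1}^n\gamma_m\alpha_m^i,\qquad B_i=\sum_{m=1}^n\gamma_m\beta_m\alpha_m^i .$$ Let $3\le k\le n-2$ and $\eta\in\mathbb F_q^*$. For odd $k$ and $0\le\ell\le\frac{k-3}2$, let $\mathcal C(D,kO,\ell,\eta)$ be the set of all $(g(P_1),\dots,g(P_n))$ with $$g=\sum_{i=0}^{(k-1)/2}a_ix^i+\sum_{j=0}^{(k-3)/2}b_jx^jy+b_\ell\,\eta\,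 x^{\frac{k+1}2},\quad a_i,b_j\in\mathbb F_q;$$ for even $k$ and $0\le\ell\le\frac k2$, let it be the set of all $(g(P_1),\dots,g(P_n))$ with $$g=\sum_{i=0}^{k/2}a_ix^i+\sum_{j=0}^{(k-4)/2}b_jx^jy+a_\ell\,\eta\, x^{\frac{k-2}2}y,\quad a_i,b_j\in\mathbb F_q.$$ For $d\ge1$ let $G(D,\omega,(y)+dO)$ be the matrix with the rows $\left(\frac{\gamma_m}{\beta_m}\alpha_m^i\right)_m$ for $0\le i\le\lfloor\frac d2\rfloor$ and $\left(\gamma_m\alpha_m^j\right)_m$ for $0\le j\le\lfloor\frac{d-3}2\rfloor$. A parity-check matrix of a linear code is a matrix whose rows form a basis of the dual code (for the Euclidean inner product). Then $p_{s-1}\ne0$ (so that the denominators below do not vanish), and: 1. Let $k$ be odd, $0\le\ell\le\frac{k-3}2$ and $R=\frac{k-3}2-\ell$. There are $a_0,\dots,a_R,b_0,\dots,b_R\in\mathbb F_q$ given by the recursion $a_0=1$, $$b_{r-1}=-\frac{\sum_{i=0}^{r-1}a_iA_{s+r-i}+\sum_{j=0}^{r-2}b_jp_{s-2+r-j}}{p_{s-1}},\qquad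 a_r=-\frac{\sum_{i=0}^{r-1}a_ip_{s-1+r-i}+\sum_{j=0}^{r-1}b_jB_{s-3+r-j}}{p_{s-1}}\qquad(1\le r\le R),$$ $$b_R=-\frac{p_{s-1}+\eta\sum_{i=0}^{R}a_iA_{s-\ell-1+\frac{k+1}2-i}+\eta\sum_{j=0}^{R-1}b_jp_{s-\ell-3+\frac{k+1}2-j}}{\eta\,p_{s-1}},$$ and with $f_1(x,y)=\sum_{i=0}^{R}a_ix^{s-\ell-1-i}+\sum_{j=0}^{R}b_jx^{s-\ell-3-j}y$, the matrix $G(D,\omega,(y)+(n-k-1)O)$ together with the extra row $\left(\frac{\gamma_m}{\beta_m}f_1(\alpha_m,\beta_m)\right)_m$ is a parity-check matrix of $\mathcal C(D,kO,\ell,\eta)$. 2. Let $k$ be even, $0\le\ell\le\frac k2$ and $R=\frac k2-\ell$. There are $e_0,\dots,e_R,h_0,\dots,h_R\in\mathbb F_q$ given by the recursion $h_0=1$, $$e_{r-1}=-\frac{\sum_{i=0}^{r-2}e_ip_{s-2+r-i}+\sum_{j=0}^{r-1}h_jB_{s-3+r-j}}{p_{s-1}},\qquad h_r=-\frac{\sum_{i=0}^{r-1}e_iA_{s+r-i}+\sum_{j=0}^{r-1}h_jp_{s-1+r-j}}{p_{s-1}}\qquad(1\le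 r\le R),$$ $$e_R=-\frac{p_{s-1}+\eta\sum_{i=0}^{R-1}e_ip_{s-\ell-i+\frac{k-2}2}+\eta\sum_{j=0}^{R}h_jB_{s-\ell-1-j+\frac{k-2}2}}{\eta\,p_{s-1}},$$ and with $f_2(x,y)=\sum_{i=0}^{R}e_ix^{s-\ell-i}+\sum_{j=0}^{R}h_jx^{s-\ell-1-j}y$, the matrix $G(D,\omega,(y)+(n-k-1)O)$ together with the extra row $\left(\frac{\gamma_m}{\beta_m}f_2(\alpha_m,\beta_m)\right)_m$ is a parity-check matrix of $\mathcal C(D,kO,\ell,\eta)$. -/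

import Mathlib

open Polynomial

/-- The data of an elliptic curve of the first type, `y² = f(x)` with `f` a square-free cubic
(not necessarily monic). -/
structure CubicCurve (K : Type*) [Field K] where
  f : K[X]
  squarefree : Squarefree f
  natDegree_eq : f.natDegree = 3

namespace CubicCurve

variable {K : Type*} [Field K] (E : CubicCurve K)

/-- The polynomial `Y² - f(X)`, in `K[X][Y]`. -/
noncomputable def poly : K[X][X] := X ^ 2 - C E.f

theorem monic_poly : E.poly.Monic := monic_X_pow_sub_C E.f two_ne_zero

theorem irreducible_poly : Irreducible E.poly := by
  by_contra h
  have hd : E.poly.natDegree = 2 := natDegree_X_pow_sub_C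
  obtain ⟨c₁, c₂, h0, h1⟩ := (E.monic_poly.not_irreducible_iff_exists_add_mul_eq_coeff hd).mp h
  have e0 : E.poly.coeff 0 = -E.f := by simp [poly]
  have e1 : E.poly.coeff 1 = 0 := by simp [poly, coeff_X_pow]
  rw [e0] at h0
  rw [e1] at h1
  have h2 : c₂ = -c₁ := by linear_combination -h1
  have h3 : E.f = c₁ ^ 2 := by rw [h2] at h0; linear_combination -h0
  have h4 := E.natDegree_eq
  rw [h3, natDegree_pow] at h4
  omega

/-- The ring `K[x, y]` of functions on the curve that are regular away from the point at
infinity `O`. -/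
abbrev CoordinateRing : Type _ := AdjoinRoot E.poly

instance : IsDomain E.CoordinateRing := AdjoinRoot.isDomain_of_prime E.irreducible_poly.prime

/-- The elliptic function field `F = K(x, y)`. -/
abbrev FunctionField : Type _ := FractionRing E.CoordinateRing

/-- The function `x`. -/
noncomputable def x : E.CoordinateRing := AdjoinRoot.of E.poly X

/-- The function `y`. -/
noncomputable def y : E.CoordinateRing := AdjoinRoot.root E.poly

/-- A rational point of the curve other than the point at infinity `O`. -/
@[ext]
structure AffinePoint where
  α : K
  β : K
  on_curve : β ^ 2 = E.f.eval α

variable {E}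

/-- The value `g(P)` of a function `g ∈ K[x, y]` at an affine rational point `P`. -/
noncomputable def AffinePoint.eval (P : E.AffinePoint) : E.CoordinateRing →ₐ[K] K :=
  AdjoinRoot.liftAlgHom E.poly (aeval P.α) P.β (by
    have h := P.on_curve
    simp [poly, eval₂_sub, h])

theorem AffinePoint.eval_x (P : E.AffinePoint) : P.eval E.x = P.α := by
  simp [AffinePoint.eval, x]

theorem AffinePoint.eval_y (P : E.AffinePoint) : P.eval E.y = P.β := by
  simp [AffinePoint.eval, y]

/-- `g ∈ F` is regular at `P`: it lies in the local ring of the curve at `P`. -/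
def AffinePoint.IsRegular (P : E.AffinePoint) (g : E.FunctionField) : Prop :=
  ∃ a b : E.CoordinateRing, P.eval b ≠ 0 ∧
    g * algebraMap E.CoordinateRing E.FunctionField b =
      algebraMap E.CoordinateRing E.FunctionField a

/-- The function `τ = x - α`. It is a local uniformizer at every point `P = (α, β)` with
`β ≠ 0`. -/
noncomputable def AffinePoint.uniformizer (P : E.AffinePoint) : E.FunctionField :=
  algebraMap E.CoordinateRing E.FunctionField (E.x - algebraMap K E.CoordinateRing P.α)

/-- `c` is the residue of the differential `ω` at the point `P = (α, β)`, where `β ≠ 0`: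
writing `ω = u dτ` with the local uniformizer `τ = x - α`, the coefficient of `τ⁻¹` in the
`τ`-adic expansion of `u` is `c`, that is, `u - ∑_{i ≤ N} a_i τ^{-(i+1)}` is regular at `P` for
some constants `a_0 = c, a_1, …, a_N`. -/
def AffinePoint.IsResidue (P : E.AffinePoint)
    (ω : KaehlerDifferential K E.FunctionField) (c : K) : Prop :=
  ∃ u : E.FunctionField, ω = u • KaehlerDifferential.D K E.FunctionField P.uniformizer ∧
    ∃ (N : ℕ) (a : ℕ → K), a 0 = c ∧
      P.IsRegular (u - ∑ i ∈ Finset.range (N + 1),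
        algebraMap K E.FunctionField (a i) * (P.uniformizer⁻¹) ^ (i + 1))

/-- The residue `res_P(ω)` at a point `P = (α, β)` with `β ≠ 0`. -/
noncomputable def AffinePoint.residue (P : E.AffinePoint)
    (ω : KaehlerDifferential K E.FunctionField) : K :=
  Classical.epsilon (P.IsResidue ω)

variable (E)

/-- The defining set `S_ℓ^{(1)}` (for odd `k`): all
`∑_{i ≤ (k-1)/2} a_i x^i + ∑_{j ≤ (k-3)/2} b_j x^j y + b_ℓ η x^{(k+1)/2}`. -/
noncomputable def definingSetOdd (k ℓ : ℕ) (η : K) : Submodule K E.CoordinateRing where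
  carrier := {g | ∃ a b : ℕ → K,
    g = ∑ i ∈ Finset.range ((k - 1) / 2 + 1), a i • E.x ^ i
      + ∑ j ∈ Finset.range ((k - 3) / 2 + 1), b j • (E.x ^ j * E.y)
      + (b ℓ * η) • E.x ^ ((k + 1) / 2)}
  add_mem' := by
    rintro _ _ ⟨a, b, rfl⟩ ⟨a', b', rfl⟩
    refine ⟨a + a', b + b', ?_⟩
    simp only [Pi.add_apply, add_smul, add_mul, Finset.sum_add_distrib]
    abel
  zero_mem' := ⟨0, 0, by simp⟩
  smul_mem' := by
    rintro c _ ⟨a, b, rfl⟩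
    refine ⟨c • a, c • b, ?_⟩
    simp only [Pi.smul_apply, smul_eq_mul, mul_smul, Finset.smul_sum, smul_add]

/-- The defining set `S_ℓ^{(2)}` (for even `k`): all
`∑_{i ≤ k/2} a_i x^i + ∑_{j ≤ (k-4)/2} b_j x^j y + a_ℓ η x^{(k-2)/2} y`. -/
noncomputable def definingSetEven (k ℓ : ℕ) (η : K) : Submodule K E.CoordinateRing where
  carrier := {g | ∃ a b : ℕ → K,
    g = ∑ i ∈ Finset.range (k / 2 + 1), a i • E.x ^ i
      + ∑ j ∈ Finset.range ((k - 4) / 2 + 1), b j • (E.x ^ j * E.y)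
      + (a ℓ * η) • (E.x ^ ((k - 2) / 2) * E.y)}
  add_mem' := by
    rintro _ _ ⟨a, b, rfl⟩ ⟨a', b', rfl⟩
    refine ⟨a + a', b + b', ?_⟩
    simp only [Pi.add_apply, add_smul, add_mul, Finset.sum_add_distrib]
    abel
  zero_mem' := ⟨0, 0, by simp⟩
  smul_mem' := by
    rintro c _ ⟨a, b, rfl⟩
    refine ⟨c • a, c • b, ?_⟩
    simp only [Pi.smul_apply, smul_eq_mul, mul_smul, Finset.smul_sum, smul_add]

variable {E} {n : ℕ}

/-- The evaluation map `g ↦ (g(P_1), …, g(P_n))`. -/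
noncomputable def ev (P : Fin n → E.AffinePoint) : E.CoordinateRing →ₗ[K] (Fin n → K) :=
  LinearMap.pi fun m => (P m).eval.toLinearMap

/-- The twisted elliptic curve code with one twist, for odd `k`. -/
noncomputable def teccOdd (P : Fin n → E.AffinePoint) (k ℓ : ℕ) (η : K) :
    Submodule K (Fin n → K) :=
  (E.definingSetOdd k ℓ η).map (ev P)

/-- The twisted elliptic curve code with one twist, for even `k`. -/
noncomputable def teccEven (P : Fin n → E.AffinePoint) (k ℓ : ℕ) (η : K) :
    Submodule K (Fin n → K) :=
  (E.definingSetEven k ℓ η).map (ev P)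

/-- `D = P_1 + ⋯ + P_n` is the conorm of a sum of rational places of `K(x)` that split completely
in `F`: the `P_m` are distinct, none of them has `y`-coordinate `0`, and with `(α, β)` the point
`(α, -β)` is also among them. -/
structure IsSplitConorm (P : Fin n → E.AffinePoint) : Prop where
  injective : Function.Injective P
  y_ne_zero : ∀ m, (P m).β ≠ 0
  neg_mem : ∀ m, ∃ m', (P m').α = (P m).α ∧ (P m').β = -(P m).β

open Classical in
/-- The function `t = ∏_{a ∈ T} (x - a)`, with `T` the set of `x`-coordinates of the `P_m`. -/
noncomputable def tFun (P : Fin n → E.AffinePoint) : E.CoordinateRing :=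
  ∏ a ∈ Finset.univ.image (fun m => (P m).α), (E.x - algebraMap K E.CoordinateRing a)

/-- The differential `ω = dx / t`. -/
noncomputable def omega (P : Fin n → E.AffinePoint) : KaehlerDifferential K E.FunctionField :=
  (algebraMap E.CoordinateRing E.FunctionField (tFun P))⁻¹ •
    KaehlerDifferential.D K E.FunctionField (algebraMap E.CoordinateRing E.FunctionField E.x)

/-- `γ_m = res_{P_m}(ω)` for `ω = dx / t`. -/
noncomputable def gam (P : Fin n → E.AffinePoint) (m : Fin n) : K :=
  (P m).residue (omega P)

/-- The residue power sum `∑_m γ_m β_m^e α_m^i`; here `e` is `-1`, `0` or `1`. -/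
noncomputable def resSum (P : Fin n → E.AffinePoint) (e : ℤ) (i : ℕ) : K :=
  ∑ m, gam P m * (P m).β ^ e * (P m).α ^ i

/-- The matrix `G(D, ω, (y) + d O)` for `d ≥ 1`: its rows are `(γ_m α_m^i / β_m)_m` for
`0 ≤ i ≤ ⌊d/2⌋` and `(γ_m α_m^j)_m` for `0 ≤ j ≤ ⌊(d-3)/2⌋` (there are `⌊(d-1)/2⌋` of the
latter). -/
noncomputable def eccMatrix (P : Fin n → E.AffinePoint) (d : ℕ) :
    Matrix (Fin (d / 2 + 1) ⊕ Fin ((d - 1) / 2)) (Fin n) K :=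
  Matrix.of (Sum.elim
    (fun i m => gam P m * (P m).α ^ (i : ℕ) / (P m).β)
    (fun j m => gam P m * (P m).α ^ (j : ℕ)))

/-- The matrix obtained from `G(D, ω, (y) + d O)` by adding the row
`(γ_m / β_m · g(P_m))_m`. -/
noncomputable def extendedMatrix (P : Fin n → E.AffinePoint) (d : ℕ) (g : E.CoordinateRing) :
    Matrix (Unit ⊕ (Fin (d / 2 + 1) ⊕ Fin ((d - 1) / 2))) (Fin n) K :=
  Matrix.of (Sum.elim
    (fun _ m => gam P m / (P m).β * (P m).eval g)
    (fun r => eccMatrix P d r))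

/-- The recursion for the coefficients of `f₁`, where `s = n/2` and `R = (k-3)/2 - ℓ`. -/
structure RecursionOdd (P : Fin n → E.AffinePoint) (s k ℓ : ℕ) (η : K) (a b : ℕ → K) :
    Prop where
  a_zero : a 0 = 1
  b_step : ∀ r ∈ Finset.Icc 1 ((k - 3) / 2 - ℓ),
    b (r - 1) = -(∑ i ∈ Finset.range r, a i * resSum P (-1) (s + r - i)
        + ∑ j ∈ Finset.range (r - 1), b j * resSum P 0 (s - 2 + r - j)) / resSum P 0 (s - 1)
  a_step : ∀ r ∈ Finset.Icc 1 ((k - 3) / 2 - ℓ),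
    a r = -(∑ i ∈ Finset.range r, a i * resSum P 0 (s - 1 + r - i)
        + ∑ j ∈ Finset.range r, b j * resSum P 1 (s - 3 + r - j)) / resSum P 0 (s - 1)
  b_last : b ((k - 3) / 2 - ℓ) =
    -(resSum P 0 (s - 1)
        + η * ∑ i ∈ Finset.range ((k - 3) / 2 - ℓ + 1),
            a i * resSum P (-1) (s + (k + 1) / 2 - ℓ - 1 - i)
        + η * ∑ j ∈ Finset.range ((k - 3) / 2 - ℓ),
            b j * resSum P 0 (s + (k + 1) / 2 - ℓ - 3 - j)) / (η * resSum P 0 (s - 1))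

/-- The recursion for the coefficients of `f₂`, where `s = n/2` and `R = k/2 - ℓ`. -/
structure RecursionEven (P : Fin n → E.AffinePoint) (s k ℓ : ℕ) (η : K) (e h : ℕ → K) :
    Prop where
  h_zero : h 0 = 1
  e_step : ∀ r ∈ Finset.Icc 1 (k / 2 - ℓ),
    e (r - 1) = -(∑ i ∈ Finset.range (r - 1), e i * resSum P 0 (s - 2 + r - i)
        + ∑ j ∈ Finset.range r, h j * resSum P 1 (s - 3 + r - j)) / resSum P 0 (s - 1)
  h_step : ∀ r ∈ Finset.Icc 1 (k / 2 - ℓ),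
    h r = -(∑ i ∈ Finset.range r, e i * resSum P (-1) (s + r - i)
        + ∑ j ∈ Finset.range r, h j * resSum P 0 (s - 1 + r - j)) / resSum P 0 (s - 1)
  e_last : e (k / 2 - ℓ) =
    -(resSum P 0 (s - 1)
        + η * ∑ i ∈ Finset.range (k / 2 - ℓ),
            e i * resSum P 0 (s + (k - 2) / 2 - ℓ - i)
        + η * ∑ j ∈ Finset.range (k / 2 - ℓ + 1),
            h j * resSum P 1 (s + (k - 2) / 2 - ℓ - 1 - j)) / (η * resSum P 0 (s - 1))

variable (E)

/-- `f₁(x, y) = ∑_{i ≤ R} a_i x^{s-ℓ-1-i} + ∑_{j ≤ R} b_j x^{s-ℓ-3-j} y`, `R = (k-3)/2 - ℓ`. -/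
noncomputable def fOdd (s k ℓ : ℕ) (a b : ℕ → K) : E.CoordinateRing :=
  ∑ i ∈ Finset.range ((k - 3) / 2 - ℓ + 1), a i • E.x ^ (s - ℓ - 1 - i)
    + ∑ j ∈ Finset.range ((k - 3) / 2 - ℓ + 1), b j • (E.x ^ (s - ℓ - 3 - j) * E.y)

/-- `f₂(x, y) = ∑_{i ≤ R} e_i x^{s-ℓ-i} + ∑_{j ≤ R} h_j x^{s-ℓ-1-j} y`, `R = k/2 - ℓ`. -/
noncomputable def fEven (s k ℓ : ℕ) (e h : ℕ → K) : E.CoordinateRing :=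
  ∑ i ∈ Finset.range (k / 2 - ℓ + 1), e i • E.x ^ (s - ℓ - i)
    + ∑ j ∈ Finset.range (k / 2 - ℓ + 1), h j • (E.x ^ (s - ℓ - 1 - j) * E.y)

end CubicCurve

/-- `H` is a parity-check matrix of the linear code `C`: its rows form a basis of the dual code
`C^⊥` with respect to the Euclidean inner product. -/
def IsParityCheckMatrix {K ι : Type*} [Field K] {n : ℕ} (H : Matrix ι (Fin n) K)
    (C : Submodule K (Fin n → K)) : Prop :=
  LinearIndependent K H.row ∧
    ∀ v : Fin n → K, v ∈ Submodule.span K (Set.range H.row) ↔ ∀ c ∈ C, v ⬝ᵥ c = 0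

/-! The points come in pairs `(α, β)`, `(α, -β)`, and `γ_m = 1 / t'(α_m)` depends on `α_m` alone
(`gam_eq`). Hence every sum that is odd in `β` vanishes; in particular all `A_i` and `B_i` are zero.
The two coupled recursions therefore separate: one sequence is the convolution inverse of `p_{s-1},
p_s, …`, scaled to start with 1, and the other is zero except for its last term `-η⁻¹`
(`recursionOdd_iff`, `recursionEven_iff`).

For the inner product weighted by `γ_m / β_m`, the evaluations of `K[x]` and of `K[x] y` are both
isotropic, again by oddness, while `u(x)` and `v(x) y` pair to `L(u v)` with `L(u) = ∑ γ_m u(α_m)`.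
By Lagrange interpolation `L(u)` is twice the coefficient of `x^(s-1)` when `deg u < s`. So `L`
kills lower powers, and `p_{s-1} = 2` is nonzero in odd characteristic. `IsDualPair` abstracts this
situation.

In such a pair the rows of `G` are orthogonal to the code for degree reasons. The extra row is `φ A
- η⁻¹ ψ (X^(s-1-p))`. The convolution inverse gives `L(A X^j) = L(X^(s-1))` for `j = ℓ` and 0 for
the other `j < q`; against the twisted generator this value is cancelled by the pairing of `-η⁻¹ ψ
(X^(s-1-p))` with the twist `η φ (X^p)`. Rows and generators are independent and number `n` in all,
so the rows span the dual. Even `k` is the same argument with `φ` and `ψ` exchanged. -/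

section LinearAlgebra

/-! ### Duality by counting dimensions. -/

variable {K : Type*} [Field K] {n : ℕ}

/-- Independent rows orthogonal to an independent generating family of complementary size form a
parity-check matrix. -/
theorem isParityCheckMatrix_of_card_add_card {ι κ : Type*} [Fintype ι] [Fintype κ]
    {H : Matrix ι (Fin n) K} {G : Matrix κ (Fin n) K}
    (hH : LinearIndependent K H.row) (hG : LinearIndependent K G.row)
    (horth : ∀ i j, H i ⬝ᵥ G j = 0) (hcard : Fintype.card ι + Fintype.card κ = n) :
    IsParityCheckMatrix H (Submodule.span K (Set.range G.row)) := by
  refine ⟨hH, ?_⟩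
  have hker : ∀ v, v ∈ LinearMap.ker G.mulVecLin ↔ ∀ c ∈ Submodule.span K (Set.range G.row),
      v ⬝ᵥ c = 0 := by
    intro v
    rw [LinearMap.mem_ker, Matrix.mulVecLin_apply]
    constructor
    · intro h c hc
      induction hc using Submodule.span_induction with
      | mem x hx =>
        obtain ⟨j, rfl⟩ := hx
        rw [dotProduct_comm]
        exact congrFun h j
      | zero => simp
      | add x y _ _ hx hy => rw [dotProduct_add, hx, hy, add_zero]
      | smul a x _ hx => rw [dotProduct_smul, hx, smul_zero]
    · intro h
      ext j
      have := h (G.row j) (Submodule.subset_span ⟨j, rfl⟩)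
      rwa [dotProduct_comm] at this
  have hle : Submodule.span K (Set.range H.row) ≤ LinearMap.ker G.mulVecLin := by
    rw [Submodule.span_le]
    rintro _ ⟨i, rfl⟩
    rw [SetLike.mem_coe, LinearMap.mem_ker, Matrix.mulVecLin_apply]
    ext j
    have := horth i j
    rwa [dotProduct_comm] at this
  have hrank : Module.finrank K (LinearMap.range G.mulVecLin) = Fintype.card κ :=
    LinearIndependent.rank_matrix hG
  have hsum := LinearMap.finrank_range_add_finrank_ker G.mulVecLin
  rw [hrank, Module.finrank_fin_fun] at hsum
  have heq : Submodule.span K (Set.range H.row) = LinearMap.ker G.mulVecLin :=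
    Submodule.eq_of_le_of_finrank_eq hle (by rw [finrank_span_eq_card hH]; omega)
  intro v
  rw [heq, hker]

theorem IsParityCheckMatrix.submatrix {ι κ : Type*} {H : Matrix ι (Fin n) K}
    {C : Submodule K (Fin n → K)} (h : IsParityCheckMatrix H C) (e : κ ≃ ι) :
    IsParityCheckMatrix (H.submatrix e id) C := by
  have hrow : (H.submatrix e id).row = H.row ∘ e := rfl
  refine ⟨?_, ?_⟩
  · rw [hrow]
    exact h.1.comp e e.injective
  · rw [hrow, e.surjective.range_comp]
    exact h.2

/-! ### Dual pairs of isotropic families. -/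

/-- Two families of vectors `φ u`, `ψ u`, indexed by polynomials, that are isotropic for the
bilinear form with weights `w` and are paired with each other by a functional `L` of the product
that vanishes in degrees below `s - 1`. -/
structure IsDualPair (w : Fin n → K) (φ ψ : K[X] →ₗ[K] (Fin n → K)) (L : K[X] →ₗ[K] K)
    (s : ℕ) : Prop where
  weight_ne_zero : ∀ m, w m ≠ 0
  eq_zero : ∀ u v : K[X], u.degree < s → v.degree < s → φ u + ψ v = 0 → u = 0 ∧ v = 0
  fst_fst : ∀ u v, (w * φ u) ⬝ᵥ φ v = 0
  snd_snd : ∀ u v, (w * ψ u) ⬝ᵥ ψ v = 0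
  fst_snd : ∀ u v, (w * φ u) ⬝ᵥ ψ v = L (u * v)
  functional_eq_zero : ∀ i < s - 1, L (X ^ i) = 0

namespace IsDualPair

variable {w : Fin n → K} {φ ψ : K[X] →ₗ[K] (Fin n → K)} {L : K[X] →ₗ[K] K} {s : ℕ}

theorem snd_fst (h : IsDualPair w φ ψ L s) (u v : K[X]) : (w * ψ u) ⬝ᵥ φ v = L (u * v) := by
  rw [mul_comm u, ← h.fst_snd]
  simp only [dotProduct, Pi.mul_apply]
  exact Finset.sum_congr rfl fun m _ => by ring

/-- This symmetry lets one argument serve both parities of `k`. -/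
theorem symm (h : IsDualPair w φ ψ L s) : IsDualPair w ψ φ L s where
  weight_ne_zero := h.weight_ne_zero
  eq_zero u v hu hv huv := (h.eq_zero v u hv hu (by rwa [add_comm])).symm
  fst_fst := h.snd_snd
  snd_snd := h.fst_fst
  fst_snd := h.snd_fst
  functional_eq_zero := h.functional_eq_zero

end IsDualPair

/-! ### Twisted codes and their check matrices in a dual pair. -/

/-- The generators `φ (X ^ i)`, `i < p`, and `ψ (X ^ j)`, `j < q`, of a code, where `ψ (X ^ ℓ)`
is twisted by `η φ (X ^ p)`. -/
noncomputable def twistedGenerator (φ ψ : K[X] →ₗ[K] (Fin n → K)) (p q ℓ : ℕ) (η : K) :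
    Matrix (Fin p ⊕ Fin q) (Fin n) K :=
  Matrix.of (Sum.elim (fun i => φ (X ^ (i : ℕ)))
    (fun j => ψ (X ^ (j : ℕ)) + if (j : ℕ) = ℓ then η • φ (X ^ p) else 0))

section

variable (φ ψ : K[X] →ₗ[K] (Fin n → K)) (p q ℓ : ℕ) (η : K)

theorem twistedGenerator_inl (i : Fin p) :
    twistedGenerator φ ψ p q ℓ η (Sum.inl i) = φ (X ^ (i : ℕ)) := rfl

theorem twistedGenerator_inr (j : Fin q) : twistedGenerator φ ψ p q ℓ η (Sum.inr j)
    = ψ (X ^ (j : ℕ)) + if (j : ℕ) = ℓ then η • φ (X ^ p) else 0 := rfl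

end

/-- The weighted rows `φ (X ^ i)`, `i < s - q`, and `ψ (X ^ j)`, `j < s - 1 - p`, together with
the row `φ A + b ψ (X ^ (s - 1 - p))`. -/
noncomputable def twistedCheck (w : Fin n → K) (φ ψ : K[X] →ₗ[K] (Fin n → K)) (s p q : ℕ)
    (A : K[X]) (b : K) : Matrix (Unit ⊕ (Fin (s - q) ⊕ Fin (s - 1 - p))) (Fin n) K :=
  Matrix.of (Sum.elim (fun _ => w * (φ A + b • ψ (X ^ (s - 1 - p))))
    (Sum.elim (fun i => w * φ (X ^ (i : ℕ))) (fun j => w * ψ (X ^ (j : ℕ)))))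

section

variable (w : Fin n → K) (φ ψ : K[X] →ₗ[K] (Fin n → K)) (s p q : ℕ) (A : K[X]) (b : K)

theorem twistedCheck_inl (x : Unit) : twistedCheck w φ ψ s p q A b (Sum.inl x)
    = w * (φ A + b • ψ (X ^ (s - 1 - p))) := rfl

theorem twistedCheck_inr_inl (i : Fin (s - q)) :
    twistedCheck w φ ψ s p q A b (Sum.inr (Sum.inl i)) = w * φ (X ^ (i : ℕ)) := rfl

theorem twistedCheck_inr_inr (j : Fin (s - 1 - p)) :
    twistedCheck w φ ψ s p q A b (Sum.inr (Sum.inr j)) = w * ψ (X ^ (j : ℕ)) := rfl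

end

theorem degree_sum_fin_smul_X_pow_lt {N M : ℕ} (hNM : N ≤ M) (c : Fin N → K) :
    (∑ i, c i • (X : K[X]) ^ (i : ℕ)).degree < M := by
  rw [← mem_degreeLT]
  refine Submodule.sum_mem _ fun i _ => Submodule.smul_mem _ _ ?_
  rw [mem_degreeLT, degree_X_pow]
  exact_mod_cast i.2.trans_le hNM

theorem degree_smul_X_pow_lt {i M : ℕ} (h : i < M) (c : K) :
    (c • (X : K[X]) ^ i).degree < M :=
  (degree_smul_le _ _).trans_lt (by rw [degree_X_pow]; exact_mod_cast h)

theorem coeff_sum_fin_smul_X_pow {N : ℕ} (c : Fin N → K) (i : Fin N) :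
    (∑ i, c i • (X : K[X]) ^ (i : ℕ)).coeff i = c i := by
  simp [finsetSum_coeff, coeff_X_pow, ← Fin.ext_iff]

theorem coeff_sum_fin_smul_X_pow_of_le {N k : ℕ} (c : Fin N → K) (hk : N ≤ k) :
    (∑ i, c i • (X : K[X]) ^ (i : ℕ)).coeff k = 0 :=
  coeff_eq_zero_of_degree_lt ((degree_sum_fin_smul_X_pow_lt le_rfl c).trans_le
    (by exact_mod_cast hk))

namespace IsDualPair

variable {w : Fin n → K} {φ ψ : K[X] →ₗ[K] (Fin n → K)} {L : K[X] →ₗ[K] K} {s : ℕ}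

/-- The twist only adds a multiple of `X ^ p` to the `φ` part. Since `p < s`, `eq_zero` still
applies, and the coefficients below `p` are not disturbed. -/
theorem linearIndependent_twistedGenerator (h : IsDualPair w φ ψ L s) {p q ℓ : ℕ} {η : K}
    (hp : p < s) (hq : q ≤ s) :
    LinearIndependent K (twistedGenerator φ ψ p q ℓ η).row := by
  rw [Fintype.linearIndependent_iff]
  intro g hg
  set c : Fin p → K := fun i => g (Sum.inl i) with hc
  set d : Fin q → K := fun j => g (Sum.inr j) with hd
  obtain ⟨e, he⟩ : ∃ e : K, φ (∑ i, c i • X ^ (i : ℕ) + e • X ^ p)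
      + ψ (∑ j, d j • X ^ (j : ℕ)) = 0 := by
    refine ⟨∑ j, d j * (if (j : ℕ) = ℓ then η else 0), ?_⟩
    rw [← hg, Fintype.sum_sum_type]
    have hite : ∀ j : Fin q, (if (j : ℕ) = ℓ then η • φ (X ^ p) else 0)
        = (if (j : ℕ) = ℓ then η else 0) • φ (X ^ p) := fun j => by split_ifs <;> simp
    simp only [map_add, map_sum, map_smul, Matrix.row, twistedGenerator_inl,
      twistedGenerator_inr, hite, smul_add, Finset.sum_add_distrib, Finset.sum_smul, mul_smul]
    abel
  obtain ⟨hu, hv⟩ := h.eq_zero _ _ (by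
    refine (degree_add_le _ _).trans_lt (max_lt (degree_sum_fin_smul_X_pow_lt hp.le c)
      (degree_smul_X_pow_lt hp e))) (degree_sum_fin_smul_X_pow_lt hq d) he
  rintro (i | j)
  · have := congrArg (fun u => coeff u i) hu
    simpa only [coeff_add, coeff_sum_fin_smul_X_pow, coeff_smul, coeff_X_pow, i.2.ne, if_false,
      smul_zero, add_zero, coeff_zero] using this
  · have := congrArg (fun u => coeff u j) hv
    simpa only [coeff_sum_fin_smul_X_pow, coeff_zero] using this

/-- After the nonzero weights are cancelled, the coefficient of `X ^ (s - 1 - p)` in the `ψ` part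
comes from the extra row alone. As `b ≠ 0`, that row drops out, and what remains is a relation
between distinct monomials. -/
theorem linearIndependent_twistedCheck (h : IsDualPair w φ ψ L s) {p q : ℕ} {A : K[X]} {b : K}
    (hp : p < s) (hA : A.degree < s) (hb : b ≠ 0) :
    LinearIndependent K (twistedCheck w φ ψ s p q A b).row := by
  rw [Fintype.linearIndependent_iff]
  intro g hg
  set e : K := g (Sum.inl ()) with he
  set c : Fin (s - q) → K := fun i => g (Sum.inr (Sum.inl i)) with hc
  set d : Fin (s - 1 - p) → K := fun j => g (Sum.inr (Sum.inr j)) with hd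
  have key : φ (∑ i, c i • X ^ (i : ℕ) + e • A)
      + ψ (∑ j, d j • X ^ (j : ℕ) + (e * b) • X ^ (s - 1 - p)) = 0 := by
    ext m
    have hm := congrFun hg m
    simp only [Fintype.sum_sum_type, Matrix.row, twistedCheck_inl, twistedCheck_inr_inl,
      twistedCheck_inr_inr, Pi.add_apply, Finset.sum_apply, Pi.smul_apply, Pi.mul_apply, smul_eq_mul,
      Finset.univ_unique, Finset.sum_singleton, Pi.zero_apply] at hm
    refine (mul_eq_zero.mp ?_).resolve_left (h.weight_ne_zero m)
    simp only [map_add, map_sum, map_smul, Pi.add_apply, Finset.sum_apply, Pi.smul_apply,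
      smul_eq_mul]
    rw [← hm]
    simp only [mul_add, Finset.mul_sum, hc, hd, he, mul_left_comm (w m)]
    ring
  obtain ⟨hu, hv⟩ := h.eq_zero _ _
    ((degree_add_le _ _).trans_lt (max_lt (degree_sum_fin_smul_X_pow_lt (by omega) c)
      ((degree_smul_le _ _).trans_lt hA)))
    ((degree_add_le _ _).trans_lt (max_lt (degree_sum_fin_smul_X_pow_lt (by omega) d)
      (degree_smul_X_pow_lt (by omega) _))) key
  have he0 : e = 0 := by
    have := congrArg (fun u => coeff u (s - 1 - p)) hv
    simp only [coeff_add, coeff_sum_fin_smul_X_pow_of_le d le_rfl, coeff_smul, coeff_X_pow,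
      if_true, smul_eq_mul, mul_one, zero_add, coeff_zero] at this
    exact (mul_eq_zero.mp this).resolve_right hb
  rw [he0, zero_smul, add_zero] at hu
  rw [he0, zero_mul, zero_smul, add_zero] at hv
  rintro (_ | i | j)
  · exact he0
  · have := congrArg (fun u => coeff u i) hu
    simpa only [coeff_sum_fin_smul_X_pow, coeff_zero] using this
  · have := congrArg (fun u => coeff u j) hv
    simpa only [coeff_sum_fin_smul_X_pow, coeff_zero] using this

/-- Isotropy and the vanishing of `L` below degree `s - 1` settle all pairings except that of the
extra row with the `ψ` generators. There `hA` leaves only `j = ℓ`, where `η * b = -1` balances the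
two contributions. -/
theorem twistedCheck_dotProduct_twistedGenerator (h : IsDualPair w φ ψ L s) {p q ℓ : ℕ}
    {A : K[X]} {b η : K} (hp : p < s)
    (hA : ∀ j < q, L (A * X ^ j) = if j = ℓ then L (X ^ (s - 1)) else 0) (hb : η * b = -1)
    (r : Unit ⊕ (Fin (s - q) ⊕ Fin (s - 1 - p))) (t : Fin p ⊕ Fin q) :
    twistedCheck w φ ψ s p q A b r ⬝ᵥ twistedGenerator φ ψ p q ℓ η t = 0 := by
  have hφ : ∀ (c : Prop) [Decidable c] (v : Fin n → K), (∀ u, v ⬝ᵥ φ u = 0) →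
      v ⬝ᵥ (if c then η • φ (X ^ p) else 0) = 0 := by
    intro c _ v hv
    split_ifs <;> simp [hv]
  have hL : ∀ i j, i + j < s - 1 → L (X ^ i * X ^ j) = 0 := fun i j hij => by
    rw [← pow_add]; exact h.functional_eq_zero _ hij
  obtain (_ | i | i) := r <;> obtain (j | j) := t <;>
    simp only [twistedCheck_inl, twistedCheck_inr_inl, twistedCheck_inr_inr,
      twistedGenerator_inl, twistedGenerator_inr]
  · rw [mul_add, add_dotProduct, h.fst_fst, mul_smul_comm, smul_dotProduct, h.snd_fst,
      hL _ _ (by omega), smul_zero, add_zero]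
  · rw [mul_add, add_dotProduct, mul_smul_comm, smul_dotProduct, dotProduct_add, dotProduct_add,
      h.fst_snd, h.snd_snd, hφ _ _ (h.fst_fst _), hA _ j.2]
    split_ifs
    · rw [dotProduct_smul, h.snd_fst, ← pow_add, show s - 1 - p + p = s - 1 by omega]
      simp only [smul_eq_mul]
      linear_combination L (X ^ (s - 1)) * hb
    · simp
  · exact h.fst_fst _ _
  · rw [dotProduct_add, h.fst_snd, hφ _ _ (h.fst_fst _), hL _ _ (by omega), add_zero]
  · rw [h.snd_fst, hL _ _ (by omega)]
  · rw [dotProduct_add, h.snd_snd, zero_add]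
    split_ifs
    · rw [dotProduct_smul, h.snd_fst, hL _ _ (by omega), smul_zero]
    · simp

theorem isParityCheckMatrix_twistedCheck (h : IsDualPair w φ ψ L s) {p q ℓ : ℕ}
    {A : K[X]} {b η : K} (hn : n = 2 * s) (hp : p < s) (hq : q ≤ s) (hdeg : A.degree < s)
    (hA : ∀ j < q, L (A * X ^ j) = if j = ℓ then L (X ^ (s - 1)) else 0) (hb : η * b = -1) :
    IsParityCheckMatrix (twistedCheck w φ ψ s p q A b)
      (Submodule.span K (Set.range (twistedGenerator φ ψ p q ℓ η).row)) :=
  isParityCheckMatrix_of_card_add_card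
    (h.linearIndependent_twistedCheck hp hdeg (by rintro rfl; simp at hb))
    (h.linearIndependent_twistedGenerator hp hq)
    (h.twistedCheck_dotProduct_twistedGenerator hp hA hb)
    (by simp only [Fintype.card_sum, Fintype.card_fin, Fintype.card_unit]; omega)

/-- The polynomial `∑_{i < q - ℓ} a_i X^(s-1-ℓ-i)` with coefficients from the inverse of the
power series of the values `L (X ^ (s - 1 + r))` satisfies the orthogonality relations. -/
theorem functional_sum_mul_X_pow (h : IsDualPair w φ ψ L s) {q ℓ : ℕ} (hℓ : ℓ < q) (hq : q ≤ s)
    {a : ℕ → K} (ha0 : a 0 = 1)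
    (ha : ∀ r ∈ Finset.Icc 1 (q - 1 - ℓ),
      ∑ i ∈ Finset.range (r + 1), a i * L (X ^ (s - 1 + r - i)) = 0)
    {j : ℕ} (hj : j < q) :
    L ((∑ i ∈ Finset.range (q - ℓ), a i • X ^ (s - 1 - ℓ - i)) * X ^ j)
      = if j = ℓ then L (X ^ (s - 1)) else 0 := by
  have hterm : L ((∑ i ∈ Finset.range (q - ℓ), a i • X ^ (s - 1 - ℓ - i)) * X ^ j)
      = ∑ i ∈ Finset.range (q - ℓ), a i * L (X ^ (s - 1 - ℓ - i + j)) := by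
    simp only [Finset.sum_mul, map_sum, smul_mul_assoc, map_smul, smul_eq_mul, pow_add]
  rw [hterm]
  -- The exponent `s - 1 + (j - ℓ) - i` is below `s - 1` exactly when `i > j - ℓ`. So no term
  -- survives for `j < ℓ`, only `i = 0` for `j = ℓ`, and for `j > ℓ` the surviving terms form the
  -- convolution with `r = j - ℓ`.
  rcases lt_trichotomy j ℓ with hlt | rfl | hgt
  · rw [if_neg hlt.ne]
    refine Finset.sum_eq_zero fun i hi => ?_
    rw [Finset.mem_range] at hi
    rw [h.functional_eq_zero _ (by omega), mul_zero]
  · rw [if_pos rfl, Finset.sum_eq_single_of_mem 0 (Finset.mem_range.mpr (by omega))]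
    · rw [ha0, one_mul, show s - 1 - j - 0 + j = s - 1 by omega]
    · intro i hi hi0
      rw [Finset.mem_range] at hi
      rw [h.functional_eq_zero _ (by omega), mul_zero]
  · rw [if_neg hgt.ne', ← ha (j - ℓ) (Finset.mem_Icc.mpr (by omega))]
    symm
    rw [← Finset.sum_subset (Finset.range_subset_range.mpr (show j - ℓ + 1 ≤ q - ℓ by omega))]
    · refine Finset.sum_congr rfl fun i hi => ?_
      rw [Finset.mem_range] at hi
      rw [show s - 1 - ℓ - i + j = s - 1 + (j - ℓ) - i by omega]
    · intro i hi hi'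
      rw [Finset.mem_range] at hi hi'
      rw [h.functional_eq_zero _ (by omega), mul_zero]

end IsDualPair

/-- A sequence with nonzero first term has an inverse under convolution. -/
theorem exists_convolution_inverse {c : ℕ → K} (hc : c 0 ≠ 0) :
    ∃ a : ℕ → K, a 0 = 1 ∧ ∀ r, 1 ≤ r → ∑ i ∈ Finset.range (r + 1), a i * c (r - i) = 0 := by
  have hinv : (PowerSeries.mk c)⁻¹ * PowerSeries.mk c = 1 :=
    PowerSeries.inv_mul_cancel _ (by simpa using hc)
  have h0 : PowerSeries.coeff 0 (PowerSeries.mk c)⁻¹ = (c 0)⁻¹ := by simp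
  -- The inverse series starts with `(c 0)⁻¹`; the factor `c 0` normalizes it to start with 1.
  refine ⟨fun i => c 0 * PowerSeries.coeff i (PowerSeries.mk c)⁻¹, ?_, fun r hr => ?_⟩
  · simp only [h0, mul_inv_cancel₀ hc]
  · have := congrArg (PowerSeries.coeff r) hinv
    rw [PowerSeries.coeff_mul, Finset.Nat.sum_antidiagonal_eq_sum_range_succ_mk,
      PowerSeries.coeff_one, if_neg (by omega)] at this
    simp only [PowerSeries.coeff_mk] at this
    simp only [mul_assoc, ← Finset.mul_sum, this, mul_zero]

end LinearAlgebra

/-! ### The coordinate ring and evaluation at points. -/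

namespace CubicCurve

variable {K : Type*} [Field K] {E : CubicCurve K}

theorem y_sq : E.y ^ 2 = AdjoinRoot.of E.poly E.f := by
  have h : AdjoinRoot.mk E.poly E.poly = 0 := AdjoinRoot.mk_self
  rw [poly, map_sub, map_pow, AdjoinRoot.mk_X, AdjoinRoot.mk_C, sub_eq_zero] at h
  exact h

theorem aeval_x (u : K[X]) : aeval E.x u = AdjoinRoot.of E.poly u := by
  have h : aeval E.x = (Algebra.ofId K[X] E.CoordinateRing).restrictScalars K := by
    ext
    simp [x, Algebra.ofId_apply, AdjoinRoot.algebraMap_eq]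
  rw [h]
  rfl

namespace AffinePoint

theorem eval_aeval_x (P : E.AffinePoint) (u : K[X]) : P.eval (aeval E.x u) = u.eval P.α := by
  rw [← Polynomial.aeval_algHom_apply, P.eval_x, coe_aeval_eq_eval]

theorem y_ne_zero {P : E.AffinePoint} (hP : P.β ≠ 0) : E.y ≠ 0 := fun h =>
  hP (by rw [← P.eval_y, h, map_zero])

theorem uniformizer_ne_zero (P : E.AffinePoint) : P.uniformizer ≠ 0 := by
  rw [uniformizer, Ne, map_eq_zero_iff _ (IsFractionRing.injective _ _)]
  have : E.x - algebraMap K E.CoordinateRing P.α = AdjoinRoot.of E.poly (X - C P.α) := by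
    rw [← aeval_x]; simp
  rw [this, ← AdjoinRoot.mk_C]
  intro h
  rw [AdjoinRoot.mk_eq_zero] at h
  have hdeg : (C (X - C P.α)).natDegree < E.poly.natDegree := by
    rw [natDegree_C, poly, natDegree_X_pow_sub_C]; norm_num
  exact E.monic_poly.not_dvd_of_natDegree_lt (C_ne_zero.mpr (X_sub_C_ne_zero P.α)) hdeg h

end AffinePoint

/-! ### The invariant derivation and the nonvanishing of `dx`. -/

section Derivation

/-- Taylor expansion stops at first order because `ε² = 0`. -/
theorem _root_.DualNumber.aeval_inl_add_inr {R A : Type*} [CommRing R] [CommRing A] [Algebra R A]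
    (p : R[X]) (a b : A) :
    aeval (TrivSqZeroExt.inl a + TrivSqZeroExt.inr b : DualNumber A) p
      = TrivSqZeroExt.inl (aeval a p) + TrivSqZeroExt.inr (aeval a (derivative p) * b) := by
  obtain ⟨c, hc⟩ := binomExpansion (p.map (algebraMap R (DualNumber A)))
    (TrivSqZeroExt.inl a) (TrivSqZeroExt.inr b)
  have hinl : ∀ q : R[X], aeval (TrivSqZeroExt.inl a : DualNumber A) q
      = TrivSqZeroExt.inl (aeval a q) := fun q => by
    have := Polynomial.aeval_algHom_apply (TrivSqZeroExt.inlAlgHom R A A) a q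
    simpa using this
  rw [derivative_map, eval_map_algebraMap, eval_map_algebraMap, eval_map_algebraMap, sq,
    TrivSqZeroExt.inr_mul_inr, mul_zero, add_zero, hinl, hinl] at hc
  rw [hc, TrivSqZeroExt.inl_mul_inr, smul_eq_mul]

variable (E)

/-- The homomorphism `g ↦ g + g' ε` to the dual numbers for the invariant derivation
`x' = 2 y`, `y' = f'(x)`, on the coordinate ring. -/
noncomputable def coordinateRingToDualNumber : E.CoordinateRing →ₐ[K] DualNumber E.FunctionField :=
  AdjoinRoot.liftAlgHom E.poly
    (aeval (TrivSqZeroExt.inl (algebraMap _ E.FunctionField E.x)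
      + TrivSqZeroExt.inr (2 * algebraMap _ E.FunctionField E.y)))
    (TrivSqZeroExt.inl (algebraMap _ E.FunctionField E.y)
      + TrivSqZeroExt.inr (algebraMap _ E.FunctionField (aeval E.x (derivative E.f)))) (by
    -- The relation to check is `(y + f'(x) ε)² = f(x + 2 y ε)`: the constant parts agree by the
    -- curve equation, and both `ε` parts are `2 y f'(x)`.
    have hy := congrArg (algebraMap E.CoordinateRing E.FunctionField) E.y_sq
    rw [← aeval_x, map_pow] at hy
    simp only [poly, eval₂_sub, eval₂_pow, eval₂_X, eval₂_C, RingHom.coe_coe,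
      DualNumber.aeval_inl_add_inr, aeval_algebraMap_apply]
    ext
    · simp
      linear_combination hy
    · simp
      rw [Algebra.smul_def]
      ring)

theorem fst_coordinateRingToDualNumber (g : E.CoordinateRing) :
    (E.coordinateRingToDualNumber g).fst = algebraMap _ E.FunctionField g := by
  have h : (TrivSqZeroExt.fstHom K E.FunctionField E.FunctionField).comp
      E.coordinateRingToDualNumber = IsScalarTower.toAlgHom K E.CoordinateRing E.FunctionField := by
    apply AdjoinRoot.algHom_ext'
    · ext
      simp [coordinateRingToDualNumber, x]
    · simp [coordinateRingToDualNumber, y]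
  exact congrArg (fun φ => φ g) h

/-- The extension of `coordinateRingToDualNumber` to the function field. -/
noncomputable def toDualNumber : E.FunctionField →ₐ[K] DualNumber E.FunctionField :=
  IsLocalization.liftAlgHom (M := nonZeroDivisors E.CoordinateRing)
    (f := E.coordinateRingToDualNumber) fun g => by
    rw [TrivSqZeroExt.isUnit_iff_isUnit_fst, fst_coordinateRingToDualNumber]
    exact IsLocalization.map_units _ g

theorem toDualNumber_algebraMap (g : E.CoordinateRing) :
    E.toDualNumber (algebraMap _ _ g) = E.coordinateRingToDualNumber g := by
  simp [toDualNumber]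

theorem fst_toDualNumber (g : E.FunctionField) : (E.toDualNumber g).fst = g := by
  have h : (TrivSqZeroExt.fstHom K E.FunctionField E.FunctionField).comp E.toDualNumber
      = AlgHom.id K E.FunctionField := by
    apply IsLocalization.algHom_ext (nonZeroDivisors E.CoordinateRing)
    refine AlgHom.ext fun g => ?_
    change (E.toDualNumber (algebraMap _ _ g)).fst = algebraMap _ _ g
    rw [toDualNumber_algebraMap, fst_coordinateRingToDualNumber]
  exact congrArg (fun φ => φ g) h

/-- The derivation of the function field with `x' = 2 y` and `y' = f'(x)`. -/
noncomputable def invariantDerivation : Derivation K E.FunctionField E.FunctionField :=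
  Derivation.mk' ((TrivSqZeroExt.sndHom E.FunctionField E.FunctionField).restrictScalars K
    ∘ₗ E.toDualNumber.toLinearMap) fun a b => by
    simp [fst_toDualNumber, mul_comm]

theorem invariantDerivation_x : E.invariantDerivation (algebraMap _ _ E.x)
    = 2 * algebraMap _ E.FunctionField E.y := by
  simp [invariantDerivation, toDualNumber_algebraMap, coordinateRingToDualNumber, x]

/-- The invariant derivation factors through the Kähler differentials and sends `dx` to `2 y ≠ 0`.
This is what makes `u` in `ω = u dτ` unique. -/
theorem D_x_ne_zero (hchar : ringChar K ≠ 2) (hy : E.y ≠ 0) :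
    KaehlerDifferential.D K E.FunctionField (algebraMap _ _ E.x) ≠ 0 := by
  intro h
  have h2 := congrArg E.invariantDerivation.liftKaehlerDifferential h
  rw [Derivation.liftKaehlerDifferential_comp_D, invariantDerivation_x, map_zero] at h2
  refine mul_ne_zero ?_ ((map_ne_zero_iff _ (IsFractionRing.injective _ _)).mpr hy) h2
  have h3 : (2 : K) ≠ 0 := Ring.two_ne_zero hchar
  intro h4
  apply h3
  apply (algebraMap K E.FunctionField).injective
  rw [map_ofNat, h4, map_zero]

end Derivation

/-! ### Residues: uniqueness, and the value at a simple pole. -/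

namespace AffinePoint

theorem uniformizer_eq (P : E.AffinePoint) :
    P.uniformizer = algebraMap E.CoordinateRing E.FunctionField (aeval E.x (X - C P.α)) := by
  simp [uniformizer]

theorem D_uniformizer (P : E.AffinePoint) :
    KaehlerDifferential.D K E.FunctionField P.uniformizer
      = KaehlerDifferential.D K E.FunctionField (algebraMap _ _ E.x) := by
  rw [uniformizer, map_sub, map_sub, ← IsScalarTower.algebraMap_apply,
    Derivation.map_algebraMap, sub_zero]

/-- A polynomial in `τ⁻¹` without constant term that is regular at `P` vanishes. -/
theorem coeff_eq_zero_of_isRegular (P : E.AffinePoint) {c : ℕ → K} {N : ℕ}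
    (h : P.IsRegular (∑ i ∈ Finset.range N,
      algebraMap K E.FunctionField (c i) * (P.uniformizer⁻¹) ^ (i + 1))) :
    ∀ i < N, c i = 0 := by
  induction N with
  | zero => simp
  | succ N ih =>
    have hN : c N = 0 := by
      obtain ⟨a, b, hb, hab⟩ := h
      have hτ := P.uniformizer_ne_zero
      -- Multiplying by `τ^(N+1)` clears all poles; evaluating at `P` then leaves only the term `i =
      -- N`.
      have h1 : (∑ i ∈ Finset.range (N + 1), algebraMap K E.CoordinateRing (c i)
          * (aeval E.x (X - C P.α)) ^ (N - i)) * b = a * (aeval E.x (X - C P.α)) ^ (N + 1) := by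
        apply IsFractionRing.injective E.CoordinateRing E.FunctionField
        rw [map_mul, map_mul, ← hab, map_sum, map_pow, ← uniformizer_eq, mul_right_comm]
        congr 1
        rw [Finset.sum_mul]
        refine Finset.sum_congr rfl fun i hi => ?_
        rw [Finset.mem_range] at hi
        rw [map_mul, map_pow, ← uniformizer_eq, ← IsScalarTower.algebraMap_apply,
          show N + 1 = (N - i) + (i + 1) by omega, pow_add, inv_pow]
        field_simp
        ring
      have h2 := congrArg P.eval h1
      rw [map_mul, map_mul, map_sum, Finset.sum_range_succ,
        Finset.sum_eq_zero (s := Finset.range N)] at h2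
      · simp only [map_mul, map_pow, eval_aeval_x, eval_sub, eval_X, eval_C, sub_self] at h2
        simpa [hb] using h2
      · intro i hi
        rw [Finset.mem_range] at hi
        simp only [map_mul, map_pow, eval_aeval_x, eval_sub, eval_X, eval_C, sub_self]
        rw [zero_pow (by omega), mul_zero]
    intro i hi
    rcases Nat.lt_succ_iff_lt_or_eq.mp hi with hi | rfl
    · refine ih ?_ i hi
      rwa [Finset.sum_range_succ, hN, map_zero, zero_mul, add_zero] at h
    · exact hN

theorem IsRegular.sub {P : E.AffinePoint} {g h : E.FunctionField} (hg : P.IsRegular g)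
    (hh : P.IsRegular h) : P.IsRegular (g - h) := by
  obtain ⟨a, b, hb, hab⟩ := hg
  obtain ⟨a', b', hb', hab'⟩ := hh
  refine ⟨a * b' - a' * b, b * b', by rw [map_mul]; exact mul_ne_zero hb hb', ?_⟩
  rw [map_sub, map_mul, map_mul, map_mul, ← hab, ← hab']
  ring

/-- Since `dx ≠ 0`, both expansions belong to the same `u`. The difference of their polar parts is
then regular at `P`, so it has zero coefficients. -/
theorem IsResidue.unique {P : E.AffinePoint} {ω : KaehlerDifferential K E.FunctionField}
    (hchar : ringChar K ≠ 2) (hP : P.β ≠ 0) {c c' : K} (h : P.IsResidue ω c)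
    (h' : P.IsResidue ω c') : c = c' := by
  obtain ⟨u, hu, N, a, rfl, ha⟩ := h
  obtain ⟨u', hu', N', a', rfl, ha'⟩ := h'
  have huu : u = u' := by
    rw [hu, ← sub_eq_zero, ← sub_smul, D_uniformizer, smul_eq_zero] at hu'
    exact sub_eq_zero.mp (hu'.resolve_right (E.D_x_ne_zero hchar (y_ne_zero hP)))
  subst huu
  -- Polar parts of different lengths are padded with zeros to a common length before being
  -- subtracted.
  have hext : ∀ (a : ℕ → K) (N M : ℕ), N ≤ M → ∑ i ∈ Finset.range (N + 1),
      algebraMap K E.FunctionField (a i) * (P.uniformizer⁻¹) ^ (i + 1)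
      = ∑ i ∈ Finset.range (M + 1), algebraMap K E.FunctionField (if i ≤ N then a i else 0)
        * (P.uniformizer⁻¹) ^ (i + 1) := by
    intro a N M hNM
    symm
    rw [← Finset.sum_subset (Finset.range_subset_range.mpr (Nat.succ_le_succ hNM))]
    · refine Finset.sum_congr rfl fun i hi => ?_
      rw [if_pos (Finset.mem_range_succ_iff.mp hi)]
    · intro i _ hi
      rw [if_neg (by simpa [Nat.lt_succ_iff] using hi), map_zero, zero_mul]
  have hreg := ha'.sub ha
  rw [hext a N _ (le_max_left N N'), hext a' N' _ (le_max_right N N'), sub_sub_sub_cancel_left,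
    ← Finset.sum_sub_distrib] at hreg
  simp only [← sub_mul, ← map_sub] at hreg
  have := P.coeff_eq_zero_of_isRegular hreg 0 (Nat.succ_pos _)
  simpa [sub_eq_zero] using this

theorem residue_eq {P : E.AffinePoint} {ω : KaehlerDifferential K E.FunctionField}
    (hchar : ringChar K ≠ 2) (hP : P.β ≠ 0) {c : K} (h : P.IsResidue ω c) :
    P.residue ω = c :=
  IsResidue.unique hchar hP (Classical.epsilon_spec ⟨c, h⟩) h

/-- The residue of `dx / t(x)` at a point above a simple zero of `t`. -/
theorem isResidue_inv_smul_D_x (P : E.AffinePoint) {t q : K[X]} (ht : t = (X - C P.α) * q)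
    (hq : q.eval P.α ≠ 0) :
    P.IsResidue ((algebraMap E.CoordinateRing E.FunctionField (aeval E.x t))⁻¹ •
      KaehlerDifferential.D K E.FunctionField (algebraMap _ _ E.x)) (q.eval P.α)⁻¹ := by
  refine ⟨_, by rw [D_uniformizer], 0, fun _ => (q.eval P.α)⁻¹, rfl, ?_⟩
  -- With `c = 1 / q(α)`, the difference `1 / (τ q) - c / τ` equals `(1 - c q) / (τ q)`. The
  -- numerator vanishes at `α`, so a factor `τ` cancels and `r / q` is regular at `P`.
  obtain ⟨r, hr⟩ : X - C P.α ∣ 1 - C (q.eval P.α)⁻¹ * q := by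
    rw [dvd_iff_isRoot]
    simp [hq]
  refine ⟨aeval E.x r, aeval E.x q, by rwa [eval_aeval_x], ?_⟩
  have hτ := P.uniformizer_ne_zero
  have hq0 : algebraMap E.CoordinateRing E.FunctionField (aeval E.x q) ≠ 0 := by
    rw [Ne, map_eq_zero_iff _ (IsFractionRing.injective _ _)]
    intro h
    have := congrArg P.eval h
    rw [eval_aeval_x, map_zero] at this
    exact hq this
  have hr' := congrArg (fun u => algebraMap E.CoordinateRing E.FunctionField (aeval E.x u)) hr
  rw [map_mul, map_mul, ← uniformizer_eq] at hr'
  simp only [map_sub, map_one, map_mul, aeval_C, ← IsScalarTower.algebraMap_apply] at hr'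
  rw [ht, map_mul, map_mul, ← uniformizer_eq, zero_add, Finset.sum_range_one, zero_add, pow_one]
  generalize algebraMap K E.FunctionField (q.eval P.α)⁻¹ = c at hr' ⊢
  field_simp
  linear_combination hr'

end AffinePoint

end CubicCurve

/-! ### Coefficient description of a twisted code. -/

section LinearAlgebra

variable {K : Type*} [Field K] {n : ℕ}

theorem mem_span_twistedGenerator {φ ψ : K[X] →ₗ[K] (Fin n → K)} {p q ℓ : ℕ} {η : K}
    (hℓ : ℓ < q) {v : Fin n → K} :
    v ∈ Submodule.span K (Set.range (twistedGenerator φ ψ p q ℓ η).row) ↔ ∃ a b : ℕ → K,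
      v = ∑ i ∈ Finset.range p, a i • φ (X ^ i) + ∑ j ∈ Finset.range q, b j • ψ (X ^ j)
        + (b ℓ * η) • φ (X ^ p) := by
  have key : ∀ a b : ℕ → K, ∑ r, (Sum.elim (fun i : Fin p => a i) (fun j : Fin q => b j) r)
      • (twistedGenerator φ ψ p q ℓ η).row r
      = ∑ i ∈ Finset.range p, a i • φ (X ^ i) + ∑ j ∈ Finset.range q, b j • ψ (X ^ j)
        + (b ℓ * η) • φ (X ^ p) := by
    intro a b
    simp only [Fintype.sum_sum_type, Matrix.row, twistedGenerator_inl, twistedGenerator_inr,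
      Sum.elim_inl, Sum.elim_inr, smul_add, Finset.sum_add_distrib]
    have htwist : ∑ j : Fin q, b j • (if (j : ℕ) = ℓ then η • φ (X ^ p) else 0)
        = (b ℓ * η) • φ (X ^ p) := by
      rw [Fintype.sum_eq_single (⟨ℓ, hℓ⟩ : Fin q) (fun j hj => by
        rw [if_neg (fun h => hj (Fin.ext h)), smul_zero]), if_pos rfl, mul_smul]
    rw [htwist, Finset.sum_range, Finset.sum_range, add_assoc]
  rw [Submodule.mem_span_range_iff_exists_fun]
  constructor
  · rintro ⟨c, rfl⟩
    -- The default 0 is never read, because `ℓ < q`.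
    refine ⟨fun i => if h : i < p then c (Sum.inl ⟨i, h⟩) else 0,
      fun j => if h : j < q then c (Sum.inr ⟨j, h⟩) else 0, ?_⟩
    rw [← key]
    refine Finset.sum_congr rfl fun r _ => ?_
    rcases r with i | j <;> simp
  · rintro ⟨a, b, rfl⟩
    exact ⟨_, key a b⟩

end LinearAlgebra

/-! ### The dual pair given by the points of the curve. -/

namespace CubicCurve

variable {K : Type*} [Field K] {E : CubicCurve K} {n s : ℕ} {P : Fin n → E.AffinePoint}

/-- Evaluation at the points of functions of `x`. -/
noncomputable def evX (P : Fin n → E.AffinePoint) : K[X] →ₗ[K] (Fin n → K) :=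
  LinearMap.pi fun m => leval (P m).α

/-- Evaluation at the points of functions of `x` times `y`. -/
noncomputable def evXY (P : Fin n → E.AffinePoint) : K[X] →ₗ[K] (Fin n → K) :=
  LinearMap.pi fun m => (P m).β • leval (P m).α

/-- The functional `u ↦ ∑_m γ_m u(α_m)`. -/
noncomputable def resFunctional (P : Fin n → E.AffinePoint) : K[X] →ₗ[K] K :=
  ∑ m, gam P m • leval (P m).α

/-- The weights `γ_m / β_m`. -/
noncomputable def resWeight (P : Fin n → E.AffinePoint) (m : Fin n) : K := gam P m / (P m).β

theorem evX_apply (u : K[X]) (m : Fin n) : evX P u m = u.eval (P m).α := rfl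

theorem evXY_apply (u : K[X]) (m : Fin n) : evXY P u m = (P m).β * u.eval (P m).α := rfl

theorem resFunctional_apply (u : K[X]) :
    resFunctional P u = ∑ m, gam P m * u.eval (P m).α := by
  simp [resFunctional, LinearMap.sum_apply]

theorem resSum_zero (i : ℕ) : resSum P 0 i = resFunctional P (X ^ i) := by
  simp [resSum, resFunctional_apply]

theorem ev_x_pow (i : ℕ) : ev P (E.x ^ i) = evX P (X ^ i) := by
  ext m
  simp [ev, evX_apply, AffinePoint.eval_x]

theorem ev_x_pow_mul_y (i : ℕ) : ev P (E.x ^ i * E.y) = evXY P (X ^ i) := by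
  ext m
  simp [ev, evXY_apply, AffinePoint.eval_x, AffinePoint.eval_y, mul_comm]

open Classical in
/-- The set of `x`-coordinates of the points. -/
noncomputable def xCoords (P : Fin n → E.AffinePoint) : Finset K :=
  Finset.univ.image fun m => (P m).α

theorem mem_xCoords (m : Fin n) : (P m).α ∈ xCoords P := by
  classical
  exact Finset.mem_image_of_mem _ (Finset.mem_univ m)

-- The residue of `dx / t` at a simple zero of `t` is `1 / t'(α)`, here written as a product over
-- the other `x`-coordinates. It does not see the sign of `β`.
open Classical in
theorem gam_eq (hchar : ringChar K ≠ 2) (m : Fin n) (hm : (P m).β ≠ 0) :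
    gam P m = (∏ b ∈ (xCoords P).erase (P m).α, ((P m).α - b))⁻¹ := by
  have ht : tFun P = aeval E.x (∏ a ∈ xCoords P, (X - C a)) := by
    simp [tFun, xCoords, map_prod]
  have hsplit := (Finset.mul_prod_erase (xCoords P) (fun a => (X - C a : K[X]))
    (mem_xCoords m)).symm
  have h := (P m).isResidue_inv_smul_D_x hsplit (by
    rw [eval_prod, Finset.prod_ne_zero_iff]
    intro b hb
    simpa [sub_eq_zero] using (Finset.ne_of_mem_erase hb).symm)
  rw [gam, omega, ht, AffinePoint.residue_eq hchar hm h, eval_prod]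
  simp

namespace IsSplitConorm

/-- Terms cancel in pairs under `(α, β) ↦ (α, -β)`, which has no fixed point because `β ≠ 0` and the
characteristic is not 2. -/
theorem sum_eq_zero_of_odd (hP : IsSplitConorm P) (hchar : ringChar K ≠ 2) {F : Fin n → K}
    (hF : ∀ m m', (P m').α = (P m).α → (P m').β = -(P m).β → F m' = -F m) :
    ∑ m, F m = 0 := by
  choose σ hσ using hP.neg_mem
  refine Finset.sum_involution (fun m _ => σ m) (fun m _ => ?_) (fun m _ _ h => ?_)
    (fun _ _ => Finset.mem_univ _) (fun m _ => ?_)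
  · rw [hF m (σ m) (hσ m).1 (hσ m).2, add_neg_cancel]
  · have h1 := (hσ m).2
    rw [h] at h1
    exact hP.y_ne_zero m ((Ring.eq_self_iff_eq_zero_of_char_ne_two hchar).mp h1.symm)
  · apply hP.injective
    ext
    · rw [(hσ _).1, (hσ _).1]
    · rw [(hσ _).2, (hσ _).2, neg_neg]

open Classical in
theorem card_fiber (hP : IsSplitConorm P) (hchar : ringChar K ≠ 2) {a : K}
    (ha : a ∈ xCoords P) : (Finset.univ.filter fun m => (P m).α = a).card = 2 := by
  obtain ⟨m, -, rfl⟩ := Finset.mem_image.mp ha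
  obtain ⟨m', hα, hβ⟩ := hP.neg_mem m
  rw [Finset.card_eq_two]
  refine ⟨m, m', ?_, ?_⟩
  · rintro rfl
    exact hP.y_ne_zero m ((Ring.eq_self_iff_eq_zero_of_char_ne_two hchar).mp hβ.symm)
  · ext i
    simp only [Finset.mem_filter_univ, Finset.mem_insert, Finset.mem_singleton]
    constructor
    · intro hi
      have hsq : (P i).β ^ 2 = (P m).β ^ 2 := by rw [(P i).on_curve, (P m).on_curve, hi]
      rcases sq_eq_sq_iff_eq_or_eq_neg.mp hsq with h | h
      · exact Or.inl (hP.injective (AffinePoint.ext hi h))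
      · exact Or.inr (hP.injective (AffinePoint.ext (hi.trans hα.symm) (h.trans hβ.symm)))
    · rintro (rfl | rfl)
      exacts [rfl, hα]

theorem sum_eq_two_mul_sum_xCoords (hP : IsSplitConorm P) (hchar : ringChar K ≠ 2) {R : Type*}
    [CommSemiring R] (F : K → R) : ∑ m, F (P m).α = 2 * ∑ a ∈ xCoords P, F a := by
  classical
  rw [← Finset.sum_fiberwise_of_maps_to' (t := xCoords P) (fun m _ => mem_xCoords m),
    Finset.mul_sum]
  refine Finset.sum_congr rfl fun a ha => ?_
  rw [Finset.sum_const, hP.card_fiber hchar ha, nsmul_eq_mul, Nat.cast_ofNat]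

theorem card_xCoords (hP : IsSplitConorm P) (hchar : ringChar K ≠ 2) (hn : n = 2 * s) :
    (xCoords P).card = s := by
  have h := hP.sum_eq_two_mul_sum_xCoords hchar (fun _ => (1 : ℕ))
  simp only [Finset.sum_const, Finset.card_univ, Fintype.card_fin, smul_eq_mul, mul_one] at h
  omega

theorem gam_eq_gam (hP : IsSplitConorm P) (hchar : ringChar K ≠ 2) {m m' : Fin n}
    (h : (P m').α = (P m).α) : gam P m' = gam P m := by
  rw [gam_eq hchar m' (hP.y_ne_zero m'), gam_eq hchar m (hP.y_ne_zero m), h]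

theorem resSum_neg_one (hP : IsSplitConorm P) (hchar : ringChar K ≠ 2) (i : ℕ) :
    resSum P (-1) i = 0 :=
  hP.sum_eq_zero_of_odd hchar fun m m' hα hβ => by
    rw [hP.gam_eq_gam hchar hα, hα, hβ, zpow_neg_one, zpow_neg_one, inv_neg]
    ring

theorem resSum_one (hP : IsSplitConorm P) (hchar : ringChar K ≠ 2) (i : ℕ) :
    resSum P 1 i = 0 :=
  hP.sum_eq_zero_of_odd hchar fun m m' hα hβ => by
    rw [hP.gam_eq_gam hchar hα, hα, hβ, zpow_one, zpow_one]
    ring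

/-- The `γ_m` are the weights in Lagrange's formula for the coefficient of `X^(s-1)` of the
interpolating polynomial; the factor 2 arises because each `x`-coordinate carries two points. -/
theorem resFunctional_eq_coeff (hP : IsSplitConorm P) (hchar : ringChar K ≠ 2) (hn : n = 2 * s)
    {u : K[X]} (hu : u.degree < s) : resFunctional P u = 2 * u.coeff (s - 1) := by
  classical
  have hcard := hP.card_xCoords hchar hn
  have hcoeff := Lagrange.coeff_eq_sum (s := xCoords P) (v := id) Function.injective_id.injOn
    (P := u) (by rwa [hcard])
  rw [hcard] at hcoeff
  rw [hcoeff, resFunctional_apply, ← hP.sum_eq_two_mul_sum_xCoords hchar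
    (fun a => u.eval (id a) / ∏ b ∈ (xCoords P).erase a, (id a - id b))]
  refine Finset.sum_congr rfl fun m _ => ?_
  rw [gam_eq hchar m (hP.y_ne_zero m), div_eq_inv_mul]
  rfl

theorem resFunctional_X_pow_pred (hP : IsSplitConorm P) (hchar : ringChar K ≠ 2)
    (hn : n = 2 * s) (hs : 0 < s) : resFunctional P (X ^ (s - 1)) = 2 := by
  rw [hP.resFunctional_eq_coeff hchar hn (by rw [degree_X_pow]; exact_mod_cast Nat.pred_lt hs.ne'),
    coeff_X_pow_self, mul_one]

theorem isDualPair (hP : IsSplitConorm P) (hchar : ringChar K ≠ 2) (hn : n = 2 * s) :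
    IsDualPair (resWeight P) (evX P) (evXY P) (resFunctional P) s where
  weight_ne_zero m := by
    classical
    refine div_ne_zero ?_ (hP.y_ne_zero m)
    rw [gam_eq hchar m (hP.y_ne_zero m), Ne, inv_eq_zero, ← Ne, Finset.prod_ne_zero_iff]
    exact fun b hb => sub_ne_zero.mpr (Finset.ne_of_mem_erase hb).symm
  eq_zero u v hu hv huv := by
    have hcard := hP.card_xCoords hchar hn
    have h2 : (2 : K) ≠ 0 := Ring.two_ne_zero hchar
    -- Adding and subtracting the values at `(α, β)` and `(α, -β)` separates `u(α)` from `β v(α)`.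
    -- Each polynomial then has `s` distinct zeros and degree below `s`.
    have hzero : ∀ a ∈ xCoords P, u.eval a = 0 ∧ v.eval a = 0 := by
      classical
      intro a ha
      obtain ⟨m, -, rfl⟩ := Finset.mem_image.mp ha
      obtain ⟨m', hα, hβ⟩ := hP.neg_mem m
      have h := congrFun huv m
      have h' := congrFun huv m'
      simp only [Pi.add_apply, evX_apply, evXY_apply, Pi.zero_apply, hα, hβ] at h h'
      constructor
      · refine (mul_eq_zero.mp (?_ : (2 : K) * _ = 0)).resolve_left h2
        linear_combination h + h'
      · refine (mul_eq_zero.mp (?_ : 2 * (P m).β * _ = 0)).resolve_left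
          (mul_ne_zero h2 (hP.y_ne_zero m))
        linear_combination h - h'
    rw [← hcard] at hu hv
    exact ⟨eq_zero_of_degree_lt_of_eval_finset_eq_zero _ hu fun a ha => (hzero a ha).1,
      eq_zero_of_degree_lt_of_eval_finset_eq_zero _ hv fun a ha => (hzero a ha).2⟩
  fst_fst u v := hP.sum_eq_zero_of_odd hchar fun m m' hα hβ => by
    simp only [Pi.mul_apply, resWeight, evX_apply, hP.gam_eq_gam hchar hα, hα, hβ, div_neg]
    ring
  snd_snd u v := hP.sum_eq_zero_of_odd hchar fun m m' hα hβ => by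
    simp only [Pi.mul_apply, resWeight, evXY_apply, hP.gam_eq_gam hchar hα, hα, hβ, div_neg]
    ring
  fst_snd u v := by
    rw [resFunctional_apply]
    refine Finset.sum_congr rfl fun m _ => ?_
    have := hP.y_ne_zero m
    simp only [Pi.mul_apply, resWeight, evX_apply, evXY_apply, eval_mul]
    field_simp
  functional_eq_zero i hi := by
    rw [hP.resFunctional_eq_coeff hchar hn (by rw [degree_X_pow]; exact_mod_cast by omega),
      coeff_X_pow, if_neg hi.ne', mul_zero]

end IsSplitConorm

/-! ### The elliptic codes as twisted codes. -/

theorem teccOdd_eq_span {k ℓ : ℕ} (η : K) (hk : 3 ≤ k) (hodd : Odd k) (hℓ : ℓ ≤ (k - 3) / 2) :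
    teccOdd P k ℓ η = Submodule.span K (Set.range
      (twistedGenerator (evX P) (evXY P) ((k + 1) / 2) ((k - 1) / 2) ℓ η).row) := by
  obtain ⟨r, rfl⟩ := hodd
  ext v
  rw [mem_span_twistedGenerator (by omega), teccOdd, Submodule.mem_map]
  have hev : ∀ a b : ℕ → K, ev P (∑ i ∈ Finset.range ((2 * r + 1 - 1) / 2 + 1), a i • E.x ^ i
      + ∑ j ∈ Finset.range ((2 * r + 1 - 3) / 2 + 1), b j • (E.x ^ j * E.y)
      + (b ℓ * η) • E.x ^ ((2 * r + 1 + 1) / 2))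
      = ∑ i ∈ Finset.range ((2 * r + 1 + 1) / 2), a i • evX P (X ^ i)
      + ∑ j ∈ Finset.range ((2 * r + 1 - 1) / 2), b j • evXY P (X ^ j)
      + (b ℓ * η) • evX P (X ^ ((2 * r + 1 + 1) / 2)) := by
    intro a b
    simp only [map_add, map_sum, map_smul, ev_x_pow, ev_x_pow_mul_y]
    rw [show (2 * r + 1 - 1) / 2 + 1 = (2 * r + 1 + 1) / 2 by omega,
      show (2 * r + 1 - 3) / 2 + 1 = (2 * r + 1 - 1) / 2 by omega]
  constructor
  · rintro ⟨_, ⟨a, b, rfl⟩, rfl⟩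
    exact ⟨a, b, hev a b⟩
  · rintro ⟨a, b, rfl⟩
    exact ⟨_, ⟨a, b, rfl⟩, hev a b⟩

/-- For even `k` the twisted monomial is a power of `x` and the twist is a multiple of `y`, so
`evXY` plays the role of `φ`. -/
theorem teccEven_eq_span {k ℓ : ℕ} (η : K) (hk : 3 ≤ k) (heven : Even k) (hℓ : ℓ ≤ k / 2) :
    teccEven P k ℓ η = Submodule.span K (Set.range
      (twistedGenerator (evXY P) (evX P) ((k - 2) / 2) (k / 2 + 1) ℓ η).row) := by
  obtain ⟨r, rfl⟩ := heven
  ext v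
  rw [mem_span_twistedGenerator (by omega), teccEven, Submodule.mem_map]
  have hev : ∀ a b : ℕ → K, ev P (∑ i ∈ Finset.range ((r + r) / 2 + 1), a i • E.x ^ i
      + ∑ j ∈ Finset.range ((r + r - 4) / 2 + 1), b j • (E.x ^ j * E.y)
      + (a ℓ * η) • (E.x ^ ((r + r - 2) / 2) * E.y))
      = ∑ j ∈ Finset.range ((r + r - 2) / 2), b j • evXY P (X ^ j)
      + ∑ i ∈ Finset.range ((r + r) / 2 + 1), a i • evX P (X ^ i)
      + (a ℓ * η) • evXY P (X ^ ((r + r - 2) / 2)) := by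
    intro a b
    simp only [map_add, map_sum, map_smul, ev_x_pow, ev_x_pow_mul_y]
    rw [show (r + r - 4) / 2 + 1 = (r + r - 2) / 2 by omega]
    congr 1
    exact add_comm _ _
  constructor
  · rintro ⟨_, ⟨a, b, rfl⟩, rfl⟩
    exact ⟨b, a, hev a b⟩
  · rintro ⟨b, a, rfl⟩
    exact ⟨_, ⟨a, b, rfl⟩, hev a b⟩

end CubicCurve

/-! ### Solving the recursions and identifying the check matrices. -/

namespace CubicCurve

variable {K : Type*} [Field K] {E : CubicCurve K} {n s k ℓ : ℕ} {P : Fin n → E.AffinePoint}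
  {η : K}

theorem eq_neg_div_iff {a b c : K} (hc : c ≠ 0) : a = -b / c ↔ b + a * c = 0 := by
  rw [eq_div_iff hc, eq_neg_iff_add_eq_zero, add_comm]

/-- The recursion for the coefficients of `f₁` when the residue power sums with odd exponent of
`y` vanish. -/
theorem recursionOdd_iff (hneg : ∀ i, resSum P (-1) i = 0) (hone : ∀ i, resSum P 1 i = 0)
    (hp : resSum P 0 (s - 1) ≠ 0) {a b : ℕ → K} :
    RecursionOdd P s k ℓ η a b ↔ a 0 = 1 ∧
      (∀ r ∈ Finset.Icc 1 ((k - 3) / 2 - ℓ),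
        ∑ i ∈ Finset.range (r + 1), a i * resSum P 0 (s - 1 + r - i) = 0) ∧
      (∀ j < (k - 3) / 2 - ℓ, b j = 0) ∧ b ((k - 3) / 2 - ℓ) = -η⁻¹ := by
  have ha : ∀ r, (a r = -(∑ i ∈ Finset.range r, a i * resSum P 0 (s - 1 + r - i)
        + ∑ j ∈ Finset.range r, b j * resSum P 1 (s - 3 + r - j)) / resSum P 0 (s - 1)) ↔
      ∑ i ∈ Finset.range (r + 1), a i * resSum P 0 (s - 1 + r - i) = 0 := fun r => by
    simp only [hone, mul_zero, Finset.sum_const_zero, add_zero]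
    rw [eq_neg_div_iff hp, Finset.sum_range_succ, Nat.add_sub_cancel]
  have hlast : (∀ j < (k - 3) / 2 - ℓ, b j = 0) → ((b ((k - 3) / 2 - ℓ) =
      -(resSum P 0 (s - 1)
        + η * ∑ i ∈ Finset.range ((k - 3) / 2 - ℓ + 1),
            a i * resSum P (-1) (s + (k + 1) / 2 - ℓ - 1 - i)
        + η * ∑ j ∈ Finset.range ((k - 3) / 2 - ℓ),
            b j * resSum P 0 (s + (k + 1) / 2 - ℓ - 3 - j)) / (η * resSum P 0 (s - 1))) ↔
      b ((k - 3) / 2 - ℓ) = -η⁻¹) := fun hb => by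
    rw [Finset.sum_eq_zero (s := Finset.range ((k - 3) / 2 - ℓ)) fun j hj => by
      rw [hb j (Finset.mem_range.mp hj), zero_mul]]
    simp only [hneg, mul_zero, Finset.sum_const_zero, add_zero]
    rw [neg_div, div_mul_cancel_right₀ hp]
  constructor
  · intro h
    -- Each `b (r - 1)` combines the sums `A_i`, which vanish, with earlier `b j`, which vanish by
    -- induction.
    have hb : ∀ j < (k - 3) / 2 - ℓ, b j = 0 := by
      intro j
      induction j using Nat.strong_induction_on with
      | _ j ih =>
        intro hj
        have := h.b_step (j + 1) (Finset.mem_Icc.mpr (by omega))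
        rw [Nat.add_sub_cancel] at this
        rw [this, Finset.sum_eq_zero (s := Finset.range j) fun i hi => by
          rw [ih i (Finset.mem_range.mp hi) ((Finset.mem_range.mp hi).trans hj), zero_mul]]
        simp [hneg]
    exact ⟨h.a_zero, fun r hr => (ha r).mp (h.a_step r hr), hb, (hlast hb).mp h.b_last⟩
  · rintro ⟨h0, h1, hb, h2⟩
    refine ⟨h0, fun r hr => ?_, fun r hr => (ha r).mpr (h1 r hr), (hlast hb).mpr h2⟩
    rw [Finset.mem_Icc] at hr
    rw [hb _ (by omega), Finset.sum_eq_zero (s := Finset.range (r - 1)) fun i hi => by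
      rw [hb i (by rw [Finset.mem_range] at hi; omega), zero_mul]]
    simp [hneg]

/-- The recursion for the coefficients of `f₂` when the residue power sums with odd exponent of
`y` vanish. -/
theorem recursionEven_iff (hneg : ∀ i, resSum P (-1) i = 0) (hone : ∀ i, resSum P 1 i = 0)
    (hp : resSum P 0 (s - 1) ≠ 0) {e h : ℕ → K} :
    RecursionEven P s k ℓ η e h ↔ h 0 = 1 ∧
      (∀ r ∈ Finset.Icc 1 (k / 2 - ℓ),
        ∑ i ∈ Finset.range (r + 1), h i * resSum P 0 (s - 1 + r - i) = 0) ∧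
      (∀ j < k / 2 - ℓ, e j = 0) ∧ e (k / 2 - ℓ) = -η⁻¹ := by
  have ha : ∀ r, (h r = -(∑ i ∈ Finset.range r, e i * resSum P (-1) (s + r - i)
        + ∑ j ∈ Finset.range r, h j * resSum P 0 (s - 1 + r - j)) / resSum P 0 (s - 1)) ↔
      ∑ i ∈ Finset.range (r + 1), h i * resSum P 0 (s - 1 + r - i) = 0 := fun r => by
    simp only [hneg, mul_zero, Finset.sum_const_zero, zero_add]
    rw [eq_neg_div_iff hp, Finset.sum_range_succ, Nat.add_sub_cancel]
  have hlast : (∀ j < k / 2 - ℓ, e j = 0) → ((e (k / 2 - ℓ) =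
      -(resSum P 0 (s - 1)
        + η * ∑ i ∈ Finset.range (k / 2 - ℓ),
            e i * resSum P 0 (s + (k - 2) / 2 - ℓ - i)
        + η * ∑ j ∈ Finset.range (k / 2 - ℓ + 1),
            h j * resSum P 1 (s + (k - 2) / 2 - ℓ - 1 - j)) / (η * resSum P 0 (s - 1))) ↔
      e (k / 2 - ℓ) = -η⁻¹) := fun he => by
    rw [Finset.sum_eq_zero (s := Finset.range (k / 2 - ℓ)) fun j hj => by
      rw [he j (Finset.mem_range.mp hj), zero_mul]]
    simp only [hone, mul_zero, Finset.sum_const_zero, add_zero]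
    rw [neg_div, div_mul_cancel_right₀ hp]
  constructor
  · intro H
    have he : ∀ j < k / 2 - ℓ, e j = 0 := by
      intro j
      induction j using Nat.strong_induction_on with
      | _ j ih =>
        intro hj
        have := H.e_step (j + 1) (Finset.mem_Icc.mpr (by omega))
        rw [Nat.add_sub_cancel] at this
        rw [this, Finset.sum_eq_zero (s := Finset.range j) fun i hi => by
          rw [ih i (Finset.mem_range.mp hi) ((Finset.mem_range.mp hi).trans hj), zero_mul]]
        simp [hone]
    exact ⟨H.h_zero, fun r hr => (ha r).mp (H.h_step r hr), he, (hlast he).mp H.e_last⟩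
  · rintro ⟨h0, h1, he, h2⟩
    refine ⟨h0, fun r hr => ?_, fun r hr => (ha r).mpr (h1 r hr), (hlast he).mpr h2⟩
    rw [Finset.mem_Icc] at hr
    rw [he _ (by omega), Finset.sum_eq_zero (s := Finset.range (r - 1)) fun i hi => by
      rw [he i (by rw [Finset.mem_range] at hi; omega), zero_mul]]
    simp [hone]

theorem exists_convolution_inverse_resSum (hp : resSum P 0 (s - 1) ≠ 0) :
    ∃ a : ℕ → K, a 0 = 1 ∧ ∀ r, 1 ≤ r →
      ∑ i ∈ Finset.range (r + 1), a i * resSum P 0 (s - 1 + r - i) = 0 := by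
  obtain ⟨a, ha0, ha⟩ := exists_convolution_inverse (c := fun r => resSum P 0 (s - 1 + r)) hp
  refine ⟨a, ha0, fun r hr => ?_⟩
  rw [← ha r hr]
  refine Finset.sum_congr rfl fun i hi => ?_
  rw [Nat.add_sub_assoc (Finset.mem_range_succ_iff.mp hi)]

theorem degree_sum_smul_X_pow_lt (a : ℕ → K) (N : ℕ) (hs : 0 < s) :
    (∑ i ∈ Finset.range N, a i • (X : K[X]) ^ (s - 1 - ℓ - i)).degree < s := by
  rw [← mem_degreeLT]
  refine Submodule.sum_mem _ fun i _ => Submodule.smul_mem _ _ ?_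
  rw [mem_degreeLT, degree_X_pow]
  exact_mod_cast by omega

theorem isParityCheckMatrix_extendedMatrix_odd (hchar : ringChar K ≠ 2) (hn : n = 2 * s)
    (hk : 3 ≤ k) (hkn : k ≤ n - 2) (hP : IsSplitConorm P) (hη : η ≠ 0) (hodd : Odd k)
    (hℓ : ℓ ≤ (k - 3) / 2) (hp : resSum P 0 (s - 1) ≠ 0) {a b : ℕ → K}
    (h : RecursionOdd P s k ℓ η a b) :
    IsParityCheckMatrix (extendedMatrix P (n - k - 1) (E.fOdd s k ℓ a b)) (teccOdd P k ℓ η) := by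
  rw [recursionOdd_iff (hP.resSum_neg_one hchar) (hP.resSum_one hchar) hp] at h
  obtain ⟨ha0, ha, hb, hbR⟩ := h
  have hmod := Nat.odd_iff.mp hodd
  have hd := hP.isDualPair hchar hn
  have hmain := hd.isParityCheckMatrix_twistedCheck (p := (k + 1) / 2) (q := (k - 1) / 2)
    (ℓ := ℓ) (b := -η⁻¹) (η := η) hn (by omega) (by omega)
    (degree_sum_smul_X_pow_lt a ((k - 1) / 2 - ℓ) (by omega))
    (fun j hj => hd.functional_sum_mul_X_pow (by omega) (by omega) ha0
      (fun r hr => by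
        simp only [← resSum_zero]
        exact ha r (by rwa [show (k - 3) / 2 - ℓ = (k - 1) / 2 - 1 - ℓ by omega])) hj)
    (by field_simp)
  rw [teccOdd_eq_span η hk hodd hℓ]
  convert hmain.submatrix (Equiv.sumCongr (Equiv.refl Unit) (Equiv.sumCongr
    (finCongr (show (n - k - 1) / 2 + 1 = s - (k - 1) / 2 by omega))
    (finCongr (show (n - k - 1 - 1) / 2 = s - 1 - (k + 1) / 2 by omega)))) using 1
  -- Of the terms with `y` only the last survives, and its exponent is `s - 1 - p` with `p = (k + 1)
  -- / 2`.
  have hf : ev P (E.fOdd s k ℓ a b)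
      = evX P (∑ i ∈ Finset.range ((k - 1) / 2 - ℓ), a i • X ^ (s - 1 - ℓ - i))
        + (-η⁻¹) • evXY P (X ^ (s - 1 - (k + 1) / 2)) := by
    rw [fOdd, map_add, Finset.sum_range_succ (n := (k - 3) / 2 - ℓ) (f := fun j => b j • _),
      Finset.sum_eq_zero (s := Finset.range ((k - 3) / 2 - ℓ)) fun j hj => by
        rw [hb j (Finset.mem_range.mp hj), zero_smul], zero_add, hbR]
    simp only [map_sum, map_smul, ev_x_pow, ev_x_pow_mul_y]
    rw [show (k - 3) / 2 - ℓ + 1 = (k - 1) / 2 - ℓ by omega,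
      show s - ℓ - 3 - ((k - 3) / 2 - ℓ) = s - 1 - (k + 1) / 2 by omega,
      show s - ℓ - 1 = s - 1 - ℓ by omega]
  ext (_ | i | j) m
  · exact congrArg (fun v => gam P m / (P m).β * v) (congrFun hf m)
  · change gam P m * (P m).α ^ (i : ℕ) / (P m).β = gam P m / (P m).β * eval (P m).α (X ^ (i : ℕ))
    rw [eval_X_pow]
    ring
  · change gam P m * (P m).α ^ (j : ℕ)
      = gam P m / (P m).β * ((P m).β * eval (P m).α (X ^ (j : ℕ)))
    have := hP.y_ne_zero m
    rw [eval_X_pow]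
    field_simp

theorem isParityCheckMatrix_extendedMatrix_even (hchar : ringChar K ≠ 2) (hn : n = 2 * s)
    (hk : 3 ≤ k) (hkn : k ≤ n - 2) (hP : IsSplitConorm P) (hη : η ≠ 0) (heven : Even k)
    (hℓ : ℓ ≤ k / 2) (hp : resSum P 0 (s - 1) ≠ 0) {e h : ℕ → K}
    (hrec : RecursionEven P s k ℓ η e h) :
    IsParityCheckMatrix (extendedMatrix P (n - k - 1) (E.fEven s k ℓ e h))
      (teccEven P k ℓ η) := by
  rw [recursionEven_iff (hP.resSum_neg_one hchar) (hP.resSum_one hchar) hp] at hrec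
  obtain ⟨hh0, hh, he, heR⟩ := hrec
  have hmod := Nat.even_iff.mp heven
  have hd := (hP.isDualPair hchar hn).symm
  have hmain := hd.isParityCheckMatrix_twistedCheck (p := (k - 2) / 2) (q := k / 2 + 1)
    (ℓ := ℓ) (b := -η⁻¹) (η := η) hn (by omega) (by omega)
    (degree_sum_smul_X_pow_lt h (k / 2 + 1 - ℓ) (by omega))
    (fun j hj => hd.functional_sum_mul_X_pow (by omega) (by omega) hh0
      (fun r hr => by
        simp only [← resSum_zero]
        exact hh r hr) hj)
    (by field_simp)
  rw [teccEven_eq_span η hk heven hℓ]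
  -- With `φ` and `ψ` exchanged, `twistedCheck` lists the rows `γ_m α_m^j` first, so `Equiv.sumComm`
  -- restores the block order of `eccMatrix`.
  convert hmain.submatrix (Equiv.sumCongr (Equiv.refl Unit) ((Equiv.sumCongr
    (finCongr (show (n - k - 1) / 2 + 1 = s - 1 - (k - 2) / 2 by omega))
    (finCongr (show (n - k - 1 - 1) / 2 = s - (k / 2 + 1) by omega))).trans
      (Equiv.sumComm _ _))) using 1
  have hf : ev P (E.fEven s k ℓ e h)
      = evXY P (∑ i ∈ Finset.range (k / 2 + 1 - ℓ), h i • X ^ (s - 1 - ℓ - i))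
        + (-η⁻¹) • evX P (X ^ (s - 1 - (k - 2) / 2)) := by
    rw [fEven, add_comm, map_add,
      Finset.sum_range_succ (n := k / 2 - ℓ) (f := fun j => e j • _),
      Finset.sum_eq_zero (s := Finset.range (k / 2 - ℓ)) fun j hj => by
        rw [he j (Finset.mem_range.mp hj), zero_smul], zero_add, heR]
    simp only [map_sum, map_smul, ev_x_pow, ev_x_pow_mul_y]
    rw [show k / 2 - ℓ + 1 = k / 2 + 1 - ℓ by omega,
      show s - ℓ - (k / 2 - ℓ) = s - 1 - (k - 2) / 2 by omega,
      show s - ℓ - 1 = s - 1 - ℓ by omega]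
  ext (_ | i | j) m
  · exact congrArg (fun v => gam P m / (P m).β * v) (congrFun hf m)
  · change gam P m * (P m).α ^ (i : ℕ) / (P m).β = gam P m / (P m).β * eval (P m).α (X ^ (i : ℕ))
    rw [eval_X_pow]
    ring
  · change gam P m * (P m).α ^ (j : ℕ)
      = gam P m / (P m).β * ((P m).β * eval (P m).α (X ^ (j : ℕ)))
    have := hP.y_ne_zero m
    rw [eval_X_pow]
    field_simp

end CubicCurve

theorem mainTheorem5 {K : Type*} [Field K] [Finite K] (hchar : ringChar K ≠ 2)
    (E : CubicCurve K) {n s k ℓ : ℕ} (hn : n = 2 * s) (hk : 3 ≤ k) (hkn : k ≤ n - 2)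
    (P : Fin n → E.AffinePoint) (hP : CubicCurve.IsSplitConorm P) (η : K) (hη : η ≠ 0) :
    CubicCurve.resSum P 0 (s - 1) ≠ 0 ∧
    (Odd k → ℓ ≤ (k - 3) / 2 →
      (∃ a b : ℕ → K, CubicCurve.RecursionOdd P s k ℓ η a b) ∧
      ∀ a b : ℕ → K, CubicCurve.RecursionOdd P s k ℓ η a b →
        IsParityCheckMatrix (CubicCurve.extendedMatrix P (n - k - 1) (E.fOdd s k ℓ a b))
          (CubicCurve.teccOdd P k ℓ η)) ∧
    (Even k → ℓ ≤ k / 2 →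
      (∃ e h : ℕ → K, CubicCurve.RecursionEven P s k ℓ η e h) ∧
      ∀ e h : ℕ → K, CubicCurve.RecursionEven P s k ℓ η e h →
        IsParityCheckMatrix (CubicCurve.extendedMatrix P (n - k - 1) (E.fEven s k ℓ e h))
          (CubicCurve.teccEven P k ℓ η)) := by
  have hp : CubicCurve.resSum P 0 (s - 1) ≠ 0 := by
    rw [CubicCurve.resSum_zero, hP.resFunctional_X_pow_pred hchar hn (by omega)]
    exact Ring.two_ne_zero hchar
  have hneg := hP.resSum_neg_one hchar
  have hone := hP.resSum_one hchar
  obtain ⟨c, hc0, hc⟩ := CubicCurve.exists_convolution_inverse_resSum hp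
  refine ⟨hp, fun hodd hℓ => ⟨⟨c, fun j => if j = (k - 3) / 2 - ℓ then -η⁻¹ else 0, ?_⟩,
    fun a b => CubicCurve.isParityCheckMatrix_extendedMatrix_odd hchar hn hk hkn hP hη hodd hℓ hp⟩,
    fun heven hℓ => ⟨⟨fun j => if j = k / 2 - ℓ then -η⁻¹ else 0, c, ?_⟩,
    fun e h => CubicCurve.isParityCheckMatrix_extendedMatrix_even hchar hn hk hkn hP hη heven hℓ
      hp⟩⟩
  · rw [CubicCurve.recursionOdd_iff hneg hone hp]
    exact ⟨hc0, fun r hr => hc r (Finset.mem_Icc.mp hr).1, fun j hj => if_neg hj.ne, if_pos rfl⟩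
  · rw [CubicCurve.recursionEven_iff hneg hone hp]
    exact ⟨hc0, fun r hr => hc r (Finset.mem_Icc.mp hr).1, fun j hj => if_neg hj.ne, if_pos rfl⟩
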